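/- All graphs are finite and simple. A graph is $d$-degenerate if each of its nonempty induced subgraphs has a vertex of degree at most $d$. A $2$-vertex-ranking of a graph $G$ (also called a unique-superior colouring or restricted star colouring) with $k$ colours is a map $\varphi:V(G)\to\{1,\ldots,k\}$ such that every connected subgraph $H$ of $G$ of diameter at most $2$ (distances being measured in $H$) contains a vertex $v$ with $\varphi(v)>\varphi(w)$ for every other vertex $w$ of $H$. The $2$-vertex-ranking number $\chi_{2\text{-vr}}(G)$ is the least $k$ for which $G$ has a $2$-vertex-ranking with $k$ colours. **Theorem.** For every positive integer $d$ there exists a constant $c=c(d)$ such that, for every integer $n\ge \max\{d,2\}$, every $n$-vertex $d$-degenerate graph $G$ satisfies $\chi_{2\text{-vr}}(G)\le c\,n^{1/3}\log n$. -/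

import Mathlib

namespace SimpleGraph

/-- `G` is `d`-degenerate: every subgraph of `G` induced by a nonempty finite set of vertices
has a vertex of degree at most `d`. -/
def IsDegenerate {V : Type*} (G : SimpleGraph V) (d : ℕ) : Prop :=
  ∀ S : Finset V, S.Nonempty → ∃ v ∈ S, {w : V | w ∈ S ∧ G.Adj v w}.ncard ≤ d

/-- `φ` is an `ℓ`-vertex-ranking of `G`: every connected subgraph `H` of `G` whose diameter
(measured in `H`) is at most `ℓ` has a vertex whose colour is larger than the colour of every
other vertex of `H`. -/
def IsVertexRanking {V : Type*} (G : SimpleGraph V) (ℓ : ℕ) (φ : V → ℕ) : Prop :=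
  ∀ H : G.Subgraph, H.Connected → H.coe.ediam ≤ (ℓ : ℕ∞) →
    ∃ v ∈ H.verts, ∀ w ∈ H.verts, w ≠ v → φ w < φ v

/-- The `ℓ`-vertex-ranking number of `G`: the least `k` such that `G` has an
`ℓ`-vertex-ranking with colours in `{1, …, k}`. -/
noncomputable def vertexRankingNumber {V : Type*} (G : SimpleGraph V) (ℓ : ℕ) : ℕ :=
  sInf {k : ℕ | ∃ φ : V → ℕ, (∀ v, φ v ∈ Set.Icc 1 k) ∧ G.IsVertexRanking ℓ φ}

/-- A finite graph with `n` vertices has an `ℓ`-vertex-ranking with `n` colours, so the minimum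
in the definition of the vertex-ranking number is attained. -/
theorem exists_isVertexRanking {V : Type*} [Fintype V] (G : SimpleGraph V) (ℓ : ℕ) :
    ∃ φ : V → ℕ, (∀ v, φ v ∈ Set.Icc 1 (Fintype.card V)) ∧ G.IsVertexRanking ℓ φ := by
  refine ⟨fun v => (Fintype.equivFin V v : ℕ) + 1,
    fun v => ⟨Nat.le_add_left _ _, (Fintype.equivFin V v).isLt⟩, ?_⟩
  · intro H hH _
    have hne : H.verts.Nonempty := hH.nonempty
    obtain ⟨v, hv, hmax⟩ := Set.exists_max_image H.verts
      (fun v => (Fintype.equivFin V v : ℕ)) H.verts.toFinite hne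
    refine ⟨v, hv, fun w hw hwv => ?_⟩
    have h1 := hmax w hw
    have h2 : (Fintype.equivFin V w : ℕ) ≠ (Fintype.equivFin V v : ℕ) := fun h =>
      hwv ((Fintype.equivFin V).injective (Fin.ext h))
    simp only at h1 ⊢
    omega

end SimpleGraph

namespace SimpleGraph

/-! Order the vertices so that each has at most `d` earlier neighbours, and let m be about n^(1/3).
Double counting edges gives O(m²) vertices with more than m later neighbours (the set `W`), and O(m)
vertices with more than m² later neighbours or more than m in `W` (the set `T`). Every vertex of `T`
can afford a private top colour.

On `W \ T`, greedy colouring handles every path of length two avoiding `T`, except those whose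
centre is a later common neighbour outside `W`: there may be about m² of these. Such a centre is
instead put in a set `R`, coloured above `W`. The price is that two vertices of `R` with a common
neighbour in `W` now need different colours, so each vertex outside `T` must have few later
neighbours in `R`.

A random choice among the colours that are free and not overloaded would give O(m log n) of them.
`exists_color_potential_le` derandomises this: averaging an exponential potential finds a good
colour at each greedy step. The vertices outside `T ∪ W` are then coloured greedily with O(m log n)
colours (`card_conflicts_le`), and `vertexRankingNumber_two_le_of_layers` stacks the palettes. -/

/-- A proper colouring in which the centre of every path on three vertices with equally coloured
ends is coloured higher than the ends is a `2`-vertex-ranking. -/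
theorem isVertexRanking_two_of_paths {V : Type*} [Finite V] {G : SimpleGraph V} {φ : V → ℕ}
    (hadj : ∀ x y, G.Adj x y → φ x ≠ φ y)
    (hpath : ∀ x z y, G.Adj x z → G.Adj z y → x ≠ y → φ x = φ y → φ x < φ z) :
    G.IsVertexRanking 2 φ := by
  intro H hH hdiam
  obtain ⟨v, hv, hmax⟩ := Set.exists_max_image H.verts φ H.verts.toFinite hH.nonempty
  refine ⟨v, hv, fun w hw hwv => lt_of_le_of_ne (hmax w hw) fun heq => ?_⟩
  have hd : H.coe.edist ⟨w, hw⟩ ⟨v, hv⟩ ≤ 2 := edist_le_ediam.trans hdiam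
  have hne : H.coe.edist ⟨w, hw⟩ ⟨v, hv⟩ ≠ ⊤ := fun h => by simp [h] at hd
  obtain ⟨p, hp⟩ := exists_walk_of_edist_ne_top hne
  rw [← hp] at hd
  have hl : p.length ≤ 2 := by exact_mod_cast hd
  match p, hl with
  | .nil, _ => exact hwv rfl
  | .cons h .nil, _ => exact hadj _ _ h.adj_sub heq
  | .cons (v := z) h (.cons h' .nil), _ =>
    -- The ends share the maximum colour of `H`, so a higher centre is impossible.
    exact absurd (hmax z z.2) (not_le.2 (heq ▸ hpath _ _ _ h.adj_sub h'.adj_sub hwv heq))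
  | .cons _ (.cons _ (.cons _ q)), hl =>
    simp only [Walk.length_cons] at hl
    omega

theorem vertexRankingNumber_le {V : Type*} {G : SimpleGraph V} {ℓ k : ℕ} {φ : V → ℕ}
    (hk : ∀ v, φ v < k) (hφ : G.IsVertexRanking ℓ φ) : G.vertexRankingNumber ℓ ≤ k := by
  refine Nat.sInf_le ⟨fun v => φ v + 1, fun v => ⟨Nat.le_add_left _ _, hk v⟩, fun H hH hd => ?_⟩
  obtain ⟨v, hv, hmax⟩ := hφ H hH hd
  exact ⟨v, hv, fun w hw hwv => Nat.succ_lt_succ (hmax w hw hwv)⟩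

/-! ### Degenerate orderings and counting along them. -/

section Ordering

variable {V : Type*} [Fintype V] (G : SimpleGraph V) (r : V → ℕ)

open Classical in
/-- The neighbours of `v` that precede it with respect to `r`. -/
noncomputable def pre (v : V) : Finset V := {w | G.Adj v w ∧ r w < r v}

open Classical in
/-- The neighbours of `v` that succeed it with respect to `r`. -/
noncomputable def post (v : V) : Finset V := {w | G.Adj v w ∧ r v < r w}

variable {G r}

theorem mem_pre {v w : V} : w ∈ G.pre r v ↔ G.Adj v w ∧ r w < r v := by simp [pre]

theorem mem_post {v w : V} : w ∈ G.post r v ↔ G.Adj v w ∧ r v < r w := by simp [post]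

theorem mem_post_iff_mem_pre {v w : V} : w ∈ G.post r v ↔ v ∈ G.pre r w := by
  rw [mem_post, mem_pre, G.adj_comm]

theorem mem_pre_or_mem_post (hr : r.Injective) {v w : V} (h : G.Adj v w) :
    w ∈ G.pre r v ∨ w ∈ G.post r v := by
  rw [mem_pre, mem_post]
  rcases lt_trichotomy (r w) (r v) with h' | h' | h'
  · exact .inl ⟨h, h'⟩
  · exact absurd (hr h').symm h.ne
  · exact .inr ⟨h, h'⟩

/-- A `d`-degenerate graph has a vertex ordering in which every vertex has at most `d`
earlier neighbours. -/
theorem IsDegenerate.exists_ordering {d : ℕ} (hG : G.IsDegenerate d) :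
    ∃ r : V → ℕ, r.Injective ∧ ∀ v, (G.pre r v).card ≤ d := by
  classical
  suffices h : ∀ (k : ℕ) (S : Finset V), S.card = k → ∃ r : V → ℕ, Set.InjOn r S ∧
      ∀ v ∈ S, (S.filter fun w => G.Adj v w ∧ r w < r v).card ≤ d by
    obtain ⟨r, hr, h⟩ := h _ Finset.univ rfl
    exact ⟨r, fun x y hxy => hr (by simp) (by simp) hxy, fun v => by
      simpa only [pre] using h v (Finset.mem_univ v)⟩
  intro k
  induction k with
  | zero =>
    intro S hS
    rw [Finset.card_eq_zero] at hS
    subst hS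
    exact ⟨fun _ => 0, by simp, by simp⟩
  | succ k ih =>
    intro S hS
    obtain ⟨v, hv, hdeg⟩ := hG S (Finset.card_pos.1 (by omega))
    obtain ⟨r, hr, hrd⟩ := ih (S.erase v) (by rw [Finset.card_erase_of_mem hv, hS]; rfl)
    -- The low-degree vertex goes last, so all its neighbours in `S` become earlier ones.
    set M := (S.erase v).sup r + 1 with hM
    have hlt : ∀ w ∈ S, w ≠ v → r w < M := fun w hw hwv =>
      Nat.lt_succ_of_le (Finset.le_sup (f := r) (Finset.mem_erase.2 ⟨hwv, hw⟩))
    refine ⟨Function.update r v M, fun x hx y hy hxy => ?_, fun x hx => ?_⟩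
    · by_cases hxv : x = v <;> by_cases hyv : y = v
      · rw [hxv, hyv]
      · have := hlt y hy hyv
        simp only [hxv, Function.update_self, Function.update_of_ne hyv] at hxy
        omega
      · have := hlt x hx hxv
        simp only [hyv, Function.update_self, Function.update_of_ne hxv] at hxy
        omega
      · rw [Function.update_of_ne hxv, Function.update_of_ne hyv] at hxy
        exact hr (by simpa [hxv] using hx) (by simpa [hyv] using hy) hxy
    · by_cases hxv : x = v
      · subst hxv
        refine le_trans ?_ hdeg
        rw [← Set.ncard_coe_finset]
        refine Set.ncard_le_ncard (fun w hw => ?_) (Set.toFinite _)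
        simp only [Finset.coe_filter, Set.mem_ofPred_eq] at hw
        exact ⟨hw.1, hw.2.1⟩
      · refine (Finset.card_le_card fun w hw => ?_).trans
          (hrd x (Finset.mem_erase.2 ⟨hxv, hx⟩))
        simp only [Finset.mem_filter, Function.update_of_ne hxv] at hw ⊢
        have hwv : w ≠ v := by
          rintro rfl
          have := hlt x hx hxv
          simp only [Function.update_self] at hw
          omega
        rw [Function.update_of_ne hwv] at hw
        exact ⟨Finset.mem_erase.2 ⟨hwv, hw.1⟩, hw.2⟩

open Classical in
/-- If each vertex of `A` has at least `k` later neighbours in `B`, then `k * |A| ≤ d * |B|`. -/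
theorem mul_card_le_of_le_card_post_inter {d k : ℕ} (hd : ∀ v, (G.pre r v).card ≤ d)
    {A B : Finset V} (hA : ∀ v ∈ A, k ≤ (G.post r v ∩ B).card) : k * A.card ≤ d * B.card := by
  rw [mul_comm k, mul_comm d]
  refine Finset.card_mul_le_card_mul (fun v w => w ∈ G.post r v) (fun v hv => ?_) fun w _ => ?_
  · refine (hA v hv).trans (Finset.card_le_card fun w hw => ?_)
    rw [Finset.mem_inter] at hw
    exact (Finset.mem_bipartiteAbove _).2 hw.symm
  · refine (Finset.card_le_card fun v hv => ?_).trans (hd w)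
    rw [Finset.mem_bipartiteBelow, mem_post_iff_mem_pre] at hv
    exact hv.2

/-- The number of earlier vertices that a vertex is in conflict with, when conflicts come from
edges and from those paths on three vertices that satisfy `Q`. -/
theorem card_conflicts_le (hr : r.Injective) {d a b : ℕ} (hd : ∀ v, (G.pre r v).card ≤ d)
    {X : Finset V} {Q : V → V → V → Prop} {x : V}
    (ha : ∀ z ∈ G.pre r x, ∀ Y : Finset V, (∀ y ∈ Y, y ∈ X ∧ y ∈ G.post r z ∧ Q x z y) →
      Y.card ≤ a)
    (hb : ∀ Z : Finset V, (∀ z ∈ Z, z ∈ G.post r x ∧ ∃ y ∈ X, z ∈ G.post r y ∧ Q x z y) →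
      Z.card ≤ b)
    {Y : Finset V} (hY : ∀ y ∈ Y, y ∈ X ∧ r y < r x ∧
      (G.Adj x y ∨ ∃ z, G.Adj x z ∧ G.Adj z y ∧ Q x z y)) :
    Y.card ≤ d + d * d + d * a + b * d := by
  classical
  set Z : Finset V := (G.post r x).filter fun z => ∃ y ∈ X, z ∈ G.post r y ∧ Q x z y
  have hsub : Y ⊆ G.pre r x ∪ (G.pre r x).biUnion (G.pre r) ∪
      (G.pre r x).biUnion (fun z => X.filter fun y => y ∈ G.post r z ∧ Q x z y) ∪
      Z.biUnion (G.pre r) := by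
    intro y hy
    obtain ⟨hyX, hyx, hxy | ⟨z, hxz, hzy, hQ⟩⟩ := hY y hy
    · simp only [Finset.mem_union, mem_pre (v := x) (w := y)]
      tauto
    · simp only [Finset.mem_union, Finset.mem_biUnion, Finset.mem_filter, Z]
      rcases mem_pre_or_mem_post hr hxz with h1 | h1 <;>
        rcases mem_pre_or_mem_post hr hzy with h2 | h2
      · exact .inl (.inl (.inr ⟨z, h1, h2⟩))
      · exact .inl (.inr ⟨z, h1, hyX, h2, hQ⟩)
      · exact .inr ⟨z, ⟨h1, y, hyX, mem_post_iff_mem_pre.2 h2, hQ⟩, h2⟩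
      -- Here `x` precedes `z` and `z` precedes `y`, against `y` preceding `x`.
      · have h3 := (mem_post.1 h1).2
        have h4 := (mem_post.1 h2).2
        omega
  refine (Finset.card_le_card hsub).trans ?_
  refine (Finset.card_union_le _ _).trans (add_le_add ((Finset.card_union_le _ _).trans
    (add_le_add ((Finset.card_union_le _ _).trans (add_le_add (hd x) ?_)) ?_)) ?_)
  · exact (Finset.card_biUnion_le_card_mul _ _ d fun z _ => hd z).trans
      (Nat.mul_le_mul_right _ (hd x))
  · exact (Finset.card_biUnion_le_card_mul _ _ a fun z hz => ha z hz _ fun y hy =>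
      Finset.mem_filter.1 hy).trans (Nat.mul_le_mul_right _ (hd x))
  · exact (Finset.card_biUnion_le_card_mul _ _ d fun z _ => hd z).trans
      (Nat.mul_le_mul_right _ (hb _ fun z hz => Finset.mem_filter.1 hz))

end Ordering
-- Derandomised greedy colouring with few collisions.
section Greedy

variable {V : Type*} [Fintype V] {G : SimpleGraph V} {r : V → ℕ}

open Classical in
/-- The later neighbours of `u` that have two distinct earlier neighbours in `S` of the same
colour. -/
noncomputable def collisions {κ : Type*} (G : SimpleGraph V) (r : V → ℕ) (φ : V → κ)
    (S : Finset V) (u : V) : Finset V :=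
  {v ∈ G.post r u | ∃ x ∈ G.pre r v, ∃ y ∈ G.pre r v, x ∈ S ∧ y ∈ S ∧ x ≠ y ∧ φ x = φ y}

open Classical in
/-- The elements of `Q` that have an earlier neighbour in `S` of colour `c`. -/
noncomputable def seeing {κ : Type*} (G : SimpleGraph V) (r : V → ℕ) (φ : V → κ)
    (S : Finset V) (Q : Finset V) (c : κ) : Finset V :=
  {v ∈ Q | ∃ y ∈ G.pre r v, y ∈ S ∧ φ y = c}

theorem mem_collisions {κ : Type*} {φ : V → κ} {S : Finset V} {u v : V} :
    v ∈ G.collisions r φ S u ↔ v ∈ G.post r u ∧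
      ∃ x ∈ G.pre r v, ∃ y ∈ G.pre r v, x ∈ S ∧ y ∈ S ∧ x ≠ y ∧ φ x = φ y := by
  simp [collisions]

theorem mem_seeing {κ : Type*} {φ : V → κ} {S Q : Finset V} {v : V} {c : κ} :
    v ∈ G.seeing r φ S Q c ↔ v ∈ Q ∧ ∃ y ∈ G.pre r v, y ∈ S ∧ φ y = c := by
  simp [seeing]

-- A new collision must involve `x`: it is a common later neighbour of `u` and `x` that already sees
-- `c`.
open Classical in
theorem card_collisions_update_le {κ : Type*} (φ : V → κ) {S : Finset V} {x : V} (hx : x ∉ S)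
    (c : κ) (u : V) :
    (G.collisions r (Function.update φ x c) (insert x S) u).card ≤
      (G.collisions r φ S u).card + (G.seeing r φ S (G.post r u ∩ G.post r x) c).card := by
  refine (Finset.card_le_card fun v hv => ?_).trans (Finset.card_union_le _ _)
  have hne : ∀ y ∈ S, y ≠ x := fun y hy h => hx (h ▸ hy)
  rw [mem_collisions] at hv
  obtain ⟨hvu, y, hy, z, hz, hyS, hzS, hyz, h⟩ := hv
  rw [Finset.mem_union, mem_collisions, mem_seeing, Finset.mem_inter]
  rw [Finset.mem_insert] at hyS hzS
  rcases hyS with rfl | hyS <;> rcases hzS with rfl | hzS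
  · exact absurd rfl hyz
  · rw [Function.update_self, Function.update_of_ne (hne z hzS)] at h
    exact .inr ⟨⟨hvu, mem_post_iff_mem_pre.2 hy⟩, z, hz, hzS, h.symm⟩
  · rw [Function.update_self, Function.update_of_ne (hne y hyS)] at h
    exact .inr ⟨⟨hvu, mem_post_iff_mem_pre.2 hz⟩, y, hy, hyS, h⟩
  · rw [Function.update_of_ne (hne z hzS), Function.update_of_ne (hne y hyS)] at h
    exact .inl ⟨hvu, y, hy, z, hz, hyS, hzS, hyz, h⟩

/-- Each vertex of `Q` sees at most `d` colours, one per earlier neighbour. -/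
theorem sum_card_seeing_le {κ : Type*} [Fintype κ] {d : ℕ} (hd : ∀ v, (G.pre r v).card ≤ d)
    (φ : V → κ) (S Q : Finset V) : ∑ c, (G.seeing r φ S Q c).card ≤ d * Q.card := by
  classical
  have h := Finset.sum_card_bipartiteAbove_eq_sum_card_bipartiteBelow (s := Finset.univ) (t := Q)
    (fun (c : κ) v => ∃ y ∈ G.pre r v, y ∈ S ∧ φ y = c)
  have h1 : ∀ c : κ, (G.seeing r φ S Q c).card =
      (Q.bipartiteAbove (fun (c : κ) v => ∃ y ∈ G.pre r v, y ∈ S ∧ φ y = c) c).card := fun c => by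
    congr 1
  rw [Finset.sum_congr rfl fun c _ => h1 c, h, mul_comm d]
  refine Finset.sum_le_card_nsmul _ _ d fun v _ => le_trans ?_ (hd v)
  refine le_trans (Finset.card_le_card fun c hc => ?_) (Finset.card_image_le (f := φ))
  obtain ⟨-, y, hy, -, hyc⟩ := (Finset.mem_bipartiteBelow _).1 hc
  exact Finset.mem_image.2 ⟨y, hy, hyc⟩

/-- One averaging step: the mean of `exp (f c / m)` over at least `d * m` values `c` is at most
`exp (2 * q / m ^ 2)` if `f ≤ m` and the sum of `f` is at most `d * q`. -/
theorem sum_exp_div_le {κ : Type*} {A : Finset κ} {f : κ → ℕ} {d m q : ℕ} (hd0 : 0 < d)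
    (hm : 0 < m) (hA : d * m ≤ A.card) (hf : ∀ c ∈ A, f c ≤ m) (hsum : ∑ c ∈ A, f c ≤ d * q) :
    ∑ c ∈ A, Real.exp (f c / m) ≤ A.card * Real.exp (2 * q / m ^ 2) := by
  have hm' : (0 : ℝ) < m := by exact_mod_cast hm
  have hd' : (0 : ℝ) < d := by exact_mod_cast hd0
  -- On [0, 1], exp t ≤ 1 + 2t.
  have h1 : ∀ c ∈ A, Real.exp (f c / m) ≤ 1 + 2 * (f c / m) := fun c hc => by
    have h0 : (0 : ℝ) ≤ f c / m := by positivity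
    have h2 : (f c : ℝ) / m ≤ 1 := (div_le_one hm').2 (by exact_mod_cast hf c hc)
    have h3 := Real.abs_exp_sub_one_le (x := (f c : ℝ) / m) (by rwa [abs_of_nonneg h0])
    rw [abs_of_nonneg h0] at h3
    linarith [le_abs_self (Real.exp (f c / m) - 1)]
  have hA' : (d : ℝ) * m ≤ A.card := by exact_mod_cast hA
  have hsum' : ∑ c ∈ A, (f c : ℝ) ≤ d * q := by exact_mod_cast hsum
  calc ∑ c ∈ A, Real.exp (f c / m) ≤ ∑ c ∈ A, (1 + 2 * ((f c : ℝ) / m)) := Finset.sum_le_sum h1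
    _ = A.card + 2 / m * ∑ c ∈ A, (f c : ℝ) := by
      rw [Finset.sum_add_distrib, Finset.mul_sum]
      simp only [Finset.sum_const, nsmul_eq_mul, mul_one]
      congr 1
      exact Finset.sum_congr rfl fun c _ => by ring
    _ ≤ A.card + 2 / m * (d * q) := by gcongr
    _ = A.card + (d * m) * (2 * q / m ^ 2) := by field_simp
    _ ≤ A.card + A.card * (2 * q / m ^ 2) := by gcongr
    _ = A.card * (2 * q / m ^ 2 + 1) := by ring
    _ ≤ A.card * Real.exp (2 * q / m ^ 2) := by
      gcongr
      exact Real.add_one_le_exp _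

open Classical in
/-- A greedy colouring step with few forbidden colours can be performed without increasing the
potential. -/
theorem exists_color_potential_le {d m k : ℕ} (hd0 : 0 < d) (hm : 0 < m)
    (hd : ∀ v, (G.pre r v).card ≤ d) {S : Finset V} {x : V} (hx : x ∉ S)
    (hpost : (G.post r x).card ≤ m ^ 2) (φ : V → Fin (2 * (k + d * m)))
    {F : Finset (Fin (2 * (k + d * m)))} (hF : F.card ≤ k) (w : V → ℝ) :
    ∃ c ∉ F, ∑ u, Real.exp ((G.collisions r (Function.update φ x c) (insert x S) u).card / m
        - (w u + 2 * (G.post r u ∩ G.post r x).card / m ^ 2)) ≤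
      ∑ u, Real.exp ((G.collisions r φ S u).card / m - w u) := by
  -- Overloaded colours, seen by at least `m` later neighbours of `x`. Avoiding them keeps each
  -- increment of collisions / m at most 1.
  set B : Finset (Fin (2 * (k + d * m))) :=
    {c | m ≤ (G.seeing r φ S (G.post r x) c).card} with hB
  set A := (F ∪ B)ᶜ with hA
  have hBcard : B.card ≤ d * m := by
    have h1 : B.card * m ≤ d * m ^ 2 := calc
      B.card * m ≤ ∑ c ∈ B, (G.seeing r φ S (G.post r x) c).card :=
        Finset.card_nsmul_le_sum B _ m fun c hc => (Finset.mem_filter.1 hc).2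
      _ ≤ ∑ c, (G.seeing r φ S (G.post r x) c).card :=
        Finset.sum_le_sum_of_subset (Finset.subset_univ _)
      _ ≤ d * (G.post r x).card := sum_card_seeing_le hd φ S _
      _ ≤ d * m ^ 2 := Nat.mul_le_mul_left _ hpost
    exact Nat.le_of_mul_le_mul_right (by nlinarith) hm
  have hAcard : d * m ≤ A.card := by
    have h1 := Finset.card_union_le F B
    rw [hA, Finset.card_compl, Fintype.card_fin]
    omega
  have hAne : A.Nonempty := Finset.card_pos.1 ((Nat.mul_pos hd0 hm).trans_le hAcard)
  have hm' : (0 : ℝ) < m := by exact_mod_cast hm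
  suffices h : ∑ c ∈ A, ∑ u, Real.exp
      ((G.collisions r (Function.update φ x c) (insert x S) u).card / m
        - (w u + 2 * (G.post r u ∩ G.post r x).card / m ^ 2)) ≤
      ∑ c ∈ A, ∑ u, Real.exp ((G.collisions r φ S u).card / m - w u) by
    obtain ⟨c, hc, hle⟩ := Finset.exists_le_of_sum_le hAne h
    refine ⟨c, fun hcF => ?_, hle⟩
    exact Finset.mem_compl.1 hc (Finset.mem_union_left _ hcF)
  -- The average over the colours in `A` is bounded separately for each `u`.
  rw [Finset.sum_comm, Finset.sum_const, nsmul_eq_mul, Finset.mul_sum]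
  refine Finset.sum_le_sum fun u _ => ?_
  set q := (G.post r u ∩ G.post r x).card with hq
  set f : Fin (2 * (k + d * m)) → ℕ := fun c =>
    (G.seeing r φ S (G.post r u ∩ G.post r x) c).card with hf
  have hfm : ∀ c ∈ A, f c ≤ m := fun c hc => by
    have h1 : c ∉ B := fun h => Finset.mem_compl.1 hc (Finset.mem_union_right _ h)
    rw [hB, Finset.mem_filter] at h1
    have h2 : (G.seeing r φ S (G.post r x) c).card < m := by
      simpa using h1
    refine le_trans (Finset.card_le_card fun v hv => ?_) h2.le
    rw [mem_seeing] at hv ⊢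
    exact ⟨(Finset.mem_inter.1 hv.1).2, hv.2⟩
  have hfsum : ∑ c ∈ A, f c ≤ d * q :=
    (Finset.sum_le_sum_of_subset (Finset.subset_univ _)).trans (sum_card_seeing_le hd φ S _)
  have key := sum_exp_div_le hd0 hm hAcard hfm hfsum
  set E := Real.exp ((G.collisions r φ S u).card / m - w u) with hE
  calc _ ≤ ∑ c ∈ A, E * Real.exp (-(2 * q / m ^ 2)) * Real.exp (f c / m) := by
        refine Finset.sum_le_sum fun c _ => ?_
        rw [hE, ← Real.exp_add, ← Real.exp_add]
        refine Real.exp_le_exp.2 ?_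
        have h1 : ((G.collisions r (Function.update φ x c) (insert x S) u).card : ℝ) ≤
            (G.collisions r φ S u).card + f c := by
          exact_mod_cast card_collisions_update_le φ hx c u
        have h2 := div_le_div_of_nonneg_right h1 hm'.le
        rw [add_div] at h2
        linarith
    _ = E * Real.exp (-(2 * q / m ^ 2)) * ∑ c ∈ A, Real.exp (f c / m) := by
        rw [Finset.mul_sum]
    _ ≤ E * Real.exp (-(2 * q / m ^ 2)) * (A.card * Real.exp (2 * q / m ^ 2)) := by gcongr
    _ = A.card * E * (Real.exp (-(2 * q / m ^ 2)) * Real.exp (2 * q / m ^ 2)) := by ring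
    _ = A.card * E := by rw [← Real.exp_add]; simp

-- The potential starts at the number of vertices, every exponent being 0, and never increases.
-- Adding vertices in increasing order makes all conflicts with `S` backward ones, at most `k` of
-- them.
open Classical in
theorem exists_coloring_potential_le (hr : r.Injective) {d m k : ℕ} (hd0 : 0 < d) (hm : 0 < m)
    (hd : ∀ v, (G.pre r v).card ≤ d) {X : Finset V} (hpost : ∀ x ∈ X, (G.post r x).card ≤ m ^ 2)
    {C : V → V → Prop} (hC : ∀ x y, C x y → C y x) (hC' : ∀ x, ¬ C x x)
    (hk : ∀ x ∈ X, ∀ Y : Finset V, (∀ y ∈ Y, y ∈ X ∧ r y < r x ∧ C x y) → Y.card ≤ k)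
    (S : Finset V) : S ⊆ X →
    ∃ φ : V → Fin (2 * (k + d * m)), (∀ x ∈ S, ∀ y ∈ S, C x y → φ x ≠ φ y) ∧
      ∑ u, Real.exp ((G.collisions r φ S u).card / m
        - ∑ x ∈ S, 2 * (G.post r u ∩ G.post r x).card / (m : ℝ) ^ 2) ≤ Fintype.card V := by
  induction S using Finset.induction_on_max_value r with
  | empty =>
    intro _
    have : 0 < d * m := Nat.mul_pos hd0 hm
    refine ⟨fun _ => ⟨0, by omega⟩, by simp, ?_⟩
    have h0 : ∀ (φ : V → Fin (2 * (k + d * m))) u, G.collisions r φ ∅ u = ∅ := fun φ u => by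
      ext v
      simp [mem_collisions]
    simp [h0]
  | insert x S hx hmax ih =>
    intro hX
    obtain ⟨φ, hφ, hpot⟩ := ih ((Finset.subset_insert x S).trans hX)
    have hxX := hX (Finset.mem_insert_self x S)
    have hF : ((S.filter (C x)).image φ).card ≤ k := by
      refine Finset.card_image_le.trans (hk x hxX _ fun y hy => ?_)
      rw [Finset.mem_filter] at hy
      refine ⟨hX (Finset.mem_insert_of_mem hy.1), lt_of_le_of_ne (hmax y hy.1) fun h => ?_, hy.2⟩
      exact hx (hr h ▸ hy.1)
    obtain ⟨c, hc, hle⟩ := exists_color_potential_le hd0 hm hd hx (hpost x hxX) φ hF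
      (fun u => ∑ x ∈ S, 2 * (G.post r u ∩ G.post r x).card / (m : ℝ) ^ 2)
    have hne : ∀ y ∈ S, y ≠ x := fun y hy h => hx (h ▸ hy)
    have hcy : ∀ y ∈ S, C x y → c ≠ φ y := fun y hy hxy h =>
      hc (Finset.mem_image.2 ⟨y, Finset.mem_filter.2 ⟨hy, hxy⟩, h.symm⟩)
    refine ⟨Function.update φ x c, fun y hy z hz hyz => ?_, ?_⟩
    · rw [Finset.mem_insert] at hy hz
      rcases hy with rfl | hy <;> rcases hz with rfl | hz
      · exact absurd hyz (hC' _)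
      · rw [Function.update_self, Function.update_of_ne (hne z hz)]
        exact hcy z hz hyz
      · rw [Function.update_self, Function.update_of_ne (hne y hy)]
        exact (hcy y hy (hC _ _ hyz)).symm
      · rw [Function.update_of_ne (hne z hz), Function.update_of_ne (hne y hy)]
        exact hφ y hy z hz hyz
    · refine le_trans (le_of_eq ?_) (hle.trans hpot)
      refine Finset.sum_congr rfl fun u _ => ?_
      rw [Finset.sum_insert hx, add_comm (2 * _ / _)]

open Classical in
/-- A vertex set in which every vertex has at most `k` conflicts with earlier vertices can be
coloured with `2 * (k + d * m)` colours such that, moreover, no vertex with at most `m ^ 2` later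
neighbours has many later neighbours that see a colour twice among their earlier neighbours. -/
theorem exists_coloring_card_collisions_le (hr : r.Injective) {d m k : ℕ} (hd0 : 0 < d)
    (hm : 0 < m) (hd : ∀ v, (G.pre r v).card ≤ d) {X : Finset V}
    (hpost : ∀ x ∈ X, (G.post r x).card ≤ m ^ 2)
    {C : V → V → Prop} (hC : ∀ x y, C x y → C y x) (hC' : ∀ x, ¬ C x x)
    (hk : ∀ x ∈ X, ∀ Y : Finset V, (∀ y ∈ Y, y ∈ X ∧ r y < r x ∧ C x y) → Y.card ≤ k) :
    ∃ φ : V → Fin (2 * (k + d * m)), (∀ x ∈ X, ∀ y ∈ X, C x y → φ x ≠ φ y) ∧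
      ∀ u, (G.post r u).card ≤ m ^ 2 →
        ((G.collisions r φ X u).card : ℝ) ≤ m * (Real.log (Fintype.card V) + 2 * d) := by
  obtain ⟨φ, hφ, hpot⟩ :=
    exists_coloring_potential_le hr hd0 hm hd hpost hC hC' hk X subset_rfl
  refine ⟨φ, hφ, fun u hu => ?_⟩
  have hm' : (0 : ℝ) < m := by exact_mod_cast hm
  have hn : (0 : ℝ) < Fintype.card V := by exact_mod_cast Fintype.card_pos_iff.2 ⟨u⟩
  -- One term is at most the whole potential; taking logarithms produces the log n.
  have h1 := (Finset.single_le_sum (f := fun u => Real.exp ((G.collisions r φ X u).card / m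
        - ∑ x ∈ X, 2 * (G.post r u ∩ G.post r x).card / (m : ℝ) ^ 2))
        (fun v _ => (Real.exp_pos _).le) (Finset.mem_univ u)).trans hpot
  rw [← Real.le_log_iff_exp_le hn] at h1
  -- Each later neighbour of `u` is counted at most `d` times, so the total correction is at most `2
  -- * d`.
  have h2 : ∑ x ∈ X, (G.post r u ∩ G.post r x).card ≤ d * m ^ 2 := by
    have h := Finset.sum_card_bipartiteAbove_eq_sum_card_bipartiteBelow (s := X) (t := G.post r u)
      (fun x v => v ∈ G.post r x)
    have h3 : ∀ x, (G.post r u ∩ G.post r x) =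
        ((G.post r u).bipartiteAbove (fun x v => v ∈ G.post r x) x) := fun x => by
      ext v
      rw [Finset.mem_inter, Finset.mem_bipartiteAbove]
    rw [Finset.sum_congr rfl fun x _ => congrArg _ (h3 x), h, mul_comm d]
    refine (Finset.sum_le_card_nsmul _ _ d fun v _ => le_trans ?_ (hd v)).trans
      (Nat.mul_le_mul_right d hu)
    refine Finset.card_le_card fun x hx => ?_
    exact mem_post_iff_mem_pre.1 ((Finset.mem_bipartiteBelow _).1 hx).2
  have h3 : ∑ x ∈ X, 2 * ((G.post r u ∩ G.post r x).card : ℝ) / (m : ℝ) ^ 2 ≤ 2 * (d : ℝ) := by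
    rw [← Finset.sum_div, ← Finset.mul_sum, div_le_iff₀ (by positivity), mul_assoc]
    have : ∑ x ∈ X, ((G.post r u ∩ G.post r x).card : ℝ) ≤ d * (m : ℝ) ^ 2 := by
      exact_mod_cast h2
    linarith
  rw [mul_comm (m : ℝ), ← div_le_iff₀ hm']
  linarith

end Greedy
-- Layering and the final bound.
section Main

variable {V : Type*} [Fintype V] {G : SimpleGraph V}

/-- A `2`-vertex-ranking with four palettes: in increasing order, one for the vertices outside
`T ∪ W ∪ R`, one for `W \ T`, one for `R`, and one for `T`, on which colours are not repeated. -/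
theorem vertexRankingNumber_two_le_of_layers {T W R : Finset V} {a b : ℕ}
    (hRW : ∀ v ∈ R, v ∉ W) (χ : V → Fin b) (ψ : V → Fin a)
    (hχ : ∀ x y, x ∉ T → y ∉ T → x ∈ W → y ∈ W → x ≠ y → χ x = χ y →
      ¬ G.Adj x y ∧ ∀ z, z ∉ T → G.Adj x z → G.Adj z y → z ∈ R)
    (hψ : ∀ x y, x ∉ T → y ∉ T → x ∉ W → y ∉ W → x ≠ y → ψ x = ψ y →
      ¬ G.Adj x y ∧ ∀ z, z ∉ T → G.Adj x z → G.Adj z y → z ∈ W ∧ ¬ (x ∈ R ∧ y ∈ R)) :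
    G.vertexRankingNumber 2 ≤ 2 * a + b + T.card := by
  classical
  obtain ⟨τ, hτinj, hτ⟩ : ∃ τ : V → ℕ, Set.InjOn τ T ∧ ∀ v ∈ T, τ v < T.card := by
    refine ⟨fun v => if h : v ∈ T then T.equivFin ⟨v, h⟩ else 0, fun x hx y hy hxy => ?_,
      fun v hv => ?_⟩
    · have hx' : x ∈ T := hx
      have hy' : y ∈ T := hy
      simp only [hx', hy', dif_pos] at hxy
      exact congrArg Subtype.val (T.equivFin.injective (Fin.ext hxy))
    · simp only [hv, dif_pos]
      exact (T.equivFin ⟨v, hv⟩).isLt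
  -- `ψ` is used in two disjoint palettes, for `R` and for the bottom layer; hence `2 * a`.
  set φ : V → ℕ := fun v => if v ∈ T then a + b + a + τ v else if v ∈ R then a + b + ψ v
    else if v ∈ W then a + χ v else ψ v with hφ
  have hcases : ∀ v, (v ∈ T ∧ φ v = a + b + a + τ v ∧ τ v < T.card) ∨
      (v ∉ T ∧ v ∈ R ∧ v ∉ W ∧ φ v = a + b + ψ v) ∨
      (v ∉ T ∧ v ∉ R ∧ v ∈ W ∧ φ v = a + χ v) ∨
      (v ∉ T ∧ v ∉ R ∧ v ∉ W ∧ φ v = ψ v) := by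
    intro v
    by_cases hT : v ∈ T
    · exact .inl ⟨hT, by simp [hφ, hT], hτ v hT⟩
    by_cases hR : v ∈ R
    · exact .inr (.inl ⟨hT, hR, hRW v hR, by simp [hφ, hT, hR]⟩)
    by_cases hW : v ∈ W
    · exact .inr (.inr (.inl ⟨hT, hR, hW, by simp [hφ, hT, hR, hW]⟩))
    · exact .inr (.inr (.inr ⟨hT, hR, hW, by simp [hφ, hT, hR, hW]⟩))
  have hsame : ∀ x y, x ≠ y → φ x = φ y →
      (x ∉ T ∧ y ∉ T ∧ x ∈ R ∧ y ∈ R ∧ x ∉ W ∧ y ∉ W ∧ ψ x = ψ y) ∨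
      (x ∉ T ∧ y ∉ T ∧ x ∈ W ∧ y ∈ W ∧ χ x = χ y ∧ φ x < a + b) ∨
      (x ∉ T ∧ y ∉ T ∧ x ∉ W ∧ y ∉ W ∧ ψ x = ψ y ∧ φ x < a) := by
    intro x y hxy h
    have hx1 := (ψ x).isLt
    have hx2 := (χ x).isLt
    have hy1 := (ψ y).isLt
    have hy2 := (χ y).isLt
    rcases hcases x with ⟨h1, h2, -⟩ | ⟨h1, h2, h3, h4⟩ | ⟨h1, h2, h3, h4⟩ | ⟨h1, h2, h3, h4⟩ <;>
    rcases hcases y with ⟨g1, g2, -⟩ | ⟨g1, g2, g3, g4⟩ | ⟨g1, g2, g3, g4⟩ | ⟨g1, g2, g3, g4⟩ <;>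
    first
    | (exfalso; omega)
    | exact absurd (hτinj h1 g1 (by omega)) hxy
    | exact .inl ⟨h1, g1, h2, g2, h3, g3, Fin.ext (by omega)⟩
    | exact .inr (.inl ⟨h1, g1, h3, g3, Fin.ext (by omega), by omega⟩)
    | exact .inr (.inr ⟨h1, g1, h3, g3, Fin.ext (by omega), by omega⟩)
  refine vertexRankingNumber_le (φ := φ) (fun v => ?_) (isVertexRanking_two_of_paths ?_ ?_)
  · have h1 := (ψ v).isLt
    have h2 := (χ v).isLt
    rcases hcases v with h | h | h | h <;> omega
  · intro x y hxy h
    rcases hsame x y hxy.ne h with ⟨h1, h2, -, -, h3, h4, h5⟩ | ⟨h1, h2, h3, h4, h5, -⟩ |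
      ⟨h1, h2, h3, h4, h5, -⟩
    · exact (hψ x y h1 h2 h3 h4 hxy.ne h5).1 hxy
    · exact (hχ x y h1 h2 h3 h4 hxy.ne h5).1 hxy
    · exact (hψ x y h1 h2 h3 h4 hxy.ne h5).1 hxy
  · intro x z y hxz hzy hxy h
    have hx1 := (ψ x).isLt
    have hz := hcases z
    rcases hsame x y hxy h with ⟨h1, h2, h6, h7, h3, h4, h5⟩ | ⟨h1, h2, h3, h4, h5, h6⟩ |
      ⟨h1, h2, h3, h4, h5, h6⟩
    · have hzT : z ∈ T := by
        by_contra hzT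
        exact ((hψ x y h1 h2 h3 h4 hxy h5).2 z hzT hxz hzy).2 ⟨h6, h7⟩
      have hx := hcases x
      simp only [h1, h6, hzT, false_and, true_and, false_or, not_true_eq_false, not_false_eq_true,
        or_false] at hx hz
      omega
    · by_cases hzT : z ∈ T
      · simp only [hzT, false_and, true_and, not_true_eq_false, or_false] at hz
        omega
      · have hzR := (hχ x y h1 h2 h3 h4 hxy h5).2 z hzT hxz hzy
        simp only [hzT, hzR, false_and, true_and, not_true_eq_false, not_false_eq_true,
          or_false, false_or] at hz
        omega
    · by_cases hzT : z ∈ T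
      · simp only [hzT, false_and, true_and, not_true_eq_false, or_false] at hz
        omega
      · have hzW := ((hψ x y h1 h2 h3 h4 hxy h5).2 z hzT hxz hzy).1
        simp only [hzT, hzW, false_and, true_and, not_true_eq_false, not_false_eq_true,
          or_false, false_or, and_false] at hz
        omega

/-- Here `ρ` bounds the later neighbours in `R` of any vertex outside `T`; it is the only source of
the logarithm. -/
theorem IsDegenerate.vertexRankingNumber_two_le {d m ρ : ℕ} (hd0 : 0 < d) (hm : 0 < m)
    (hG : G.IsDegenerate d) (hn : Fintype.card V ≤ m ^ 3)
    (hρ : (m : ℝ) * (Real.log (Fintype.card V) + 2 * d) ≤ ρ) :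
    G.vertexRankingNumber 2 ≤
      2 * (2 * (d + d * d + d * (m + ρ) + m * d + d * m)) +
        2 * (d + d * d + d * m + m * d + d * m) + (d * m + d * d * m) := by
  classical
  obtain ⟨r, hr, hd⟩ := hG.exists_ordering
  set W : Finset V := {v | m < (G.post r v).card} with hW
  set T : Finset V := {v | m ^ 2 < (G.post r v).card ∨ m < (G.post r v ∩ W).card} with hT
  have hWcard : W.card ≤ d * m ^ 2 := by
    have h := mul_card_le_of_le_card_post_inter hd (A := W) (B := Finset.univ) (k := m)
      fun v hv => by simpa using (Finset.mem_filter.1 hv).2.le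
    rw [Finset.card_univ] at h
    refine Nat.le_of_mul_le_mul_left (h.trans ?_) hm
    calc d * Fintype.card V ≤ d * m ^ 3 := Nat.mul_le_mul_left _ hn
      _ = m * (d * m ^ 2) := by ring
  have hTcard : T.card ≤ d * m + d * d * m := by
    rw [hT, Finset.filter_or]
    refine (Finset.card_union_le _ _).trans (add_le_add ?_ ?_)
    · have h := mul_card_le_of_le_card_post_inter hd
        (A := Finset.univ.filter fun v => m ^ 2 < (G.post r v).card) (B := Finset.univ)
        (k := m ^ 2) fun v hv => by simpa using (Finset.mem_filter.1 hv).2.le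
      rw [Finset.card_univ] at h
      refine Nat.le_of_mul_le_mul_left (h.trans ?_) (pow_pos hm 2)
      calc d * Fintype.card V ≤ d * m ^ 3 := Nat.mul_le_mul_left _ hn
        _ = m ^ 2 * (d * m) := by ring
    · have h := mul_card_le_of_le_card_post_inter hd
        (A := Finset.univ.filter fun v => m < (G.post r v ∩ W).card) (B := W)
        (k := m) fun v hv => (Finset.mem_filter.1 hv).2.le
      refine Nat.le_of_mul_le_mul_left (h.trans ?_) hm
      calc d * W.card ≤ d * (d * m ^ 2) := Nat.mul_le_mul_left _ hWcard
        _ = m * (d * d * m) := by ring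
  have hnW : ∀ v, v ∉ W → (G.post r v).card ≤ m := fun v hv => by simpa [hW] using hv
  have hnT : ∀ v, v ∉ T → (G.post r v).card ≤ m ^ 2 ∧ (G.post r v ∩ W).card ≤ m :=
    fun v hv => by simpa [hT] using hv
  -- colouring of `W \ T`
  set Q₁ : V → V → V → Prop := fun x z y => z ∉ T ∧ ¬ (z ∉ W ∧ z ∈ G.post r x ∧ z ∈ G.post r y)
    with hQ₁
  set X : Finset V := W.filter (· ∉ T) with hX
  obtain ⟨χ, hχ, hcol⟩ := exists_coloring_card_collisions_le (G := G) (m := m)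
    (k := d + d * d + d * m + m * d) hr hd0 hm hd (X := X)
    (fun x hx => (hnT x (Finset.mem_filter.1 hx).2).1)
    (C := fun x y => x ≠ y ∧ (G.Adj x y ∨ ∃ z, G.Adj x z ∧ G.Adj z y ∧ Q₁ x z y))
    (fun x y h => ⟨h.1.symm, h.2.imp (fun h => h.symm) fun ⟨z, h1, h2, h3, h4⟩ =>
      ⟨z, h2.symm, h1.symm, h3, fun h => h4 ⟨h.1, h.2.2, h.2.1⟩⟩⟩)
    (fun x h => h.1 rfl) (fun x hx Y hY => card_conflicts_le hr hd (Q := Q₁) (X := X) (x := x)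
      (fun z _ Z hZ => by
        rcases Z.eq_empty_or_nonempty with rfl | ⟨y, hy⟩
        · simp
        · refine (Finset.card_le_card fun y hy => ?_).trans (hnT z (hZ y hy).2.2.1).2
          exact Finset.mem_inter.2 ⟨(hZ y hy).2.1, (Finset.mem_filter.1 (hZ y hy).1).1⟩)
      -- A later common neighbour outside `W` is exempt in `Q₁`, so `z` lies in `W`; as `x ∉ T`, at
      -- most `m` such `z` exist.
      (fun Z hZ => by
        refine (Finset.card_le_card fun z hz => ?_).trans (hnT x (Finset.mem_filter.1 hx).2).2
        obtain ⟨h1, y, -, h2, -, h3⟩ := hZ z hz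
        refine Finset.mem_inter.2 ⟨h1, ?_⟩
        by_contra h
        exact h3 ⟨h, h1, h2⟩)
      (fun y hy => ⟨(hY y hy).1, (hY y hy).2.1, (hY y hy).2.2.2⟩))
  -- the vertices outside `T ∪ W` that must be coloured above `W`
  set R : Finset V := {v | v ∉ T ∧ v ∉ W ∧
    ∃ x ∈ G.pre r v, ∃ y ∈ G.pre r v, x ∈ X ∧ y ∈ X ∧ x ≠ y ∧ χ x = χ y} with hR
  -- Later neighbours of `z` in `R` are collisions at `z` for `χ`.
  have hRcard : ∀ z, z ∉ T → (G.post r z ∩ R).card ≤ ρ := fun z hz => by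
    have h1 := (hcol z (hnT z hz).1).trans hρ
    refine le_trans (Finset.card_le_card fun v hv => ?_) (Nat.cast_le.1 h1)
    rw [Finset.mem_inter, hR, Finset.mem_filter] at hv
    exact mem_collisions.2 ⟨hv.1, hv.2.2.2.2⟩
  -- colouring of the vertices outside `T ∪ W`
  set Q₂ : V → V → V → Prop := fun x z y => z ∉ T ∧ (z ∈ W → x ∈ R ∧ y ∈ R) with hQ₂
  set L : Finset V := {v | v ∉ T ∧ v ∉ W} with hL
  have hLm : ∀ x ∈ L, (G.post r x).card ≤ m := fun x hx => hnW x (Finset.mem_filter.1 hx).2.2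
  -- Only the proper greedy colouring is needed here; the collision bound is dropped.
  obtain ⟨ψ, hψ, -⟩ := exists_coloring_card_collisions_le (G := G) (m := m)
    (k := d + d * d + d * (m + ρ) + m * d) hr hd0 hm hd (X := L)
    (fun x hx => (hLm x hx).trans (Nat.le_self_pow (by norm_num) m))
    (C := fun x y => x ≠ y ∧ (G.Adj x y ∨ ∃ z, G.Adj x z ∧ G.Adj z y ∧ Q₂ x z y))
    (fun x y h => ⟨h.1.symm, h.2.imp (fun h => h.symm) fun ⟨z, h1, h2, h3, h4⟩ =>
      ⟨z, h2.symm, h1.symm, h3, fun h => (h4 h).symm⟩⟩)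
    (fun x h => h.1 rfl) (fun x hx Y hY => card_conflicts_le hr hd (Q := Q₂) (X := L) (x := x)
      (fun z _ Z hZ => by
        rcases Z.eq_empty_or_nonempty with rfl | ⟨y, hy⟩
        · simp
        · by_cases hz : z ∈ W
          · refine le_trans ((Finset.card_le_card fun y hy => ?_).trans
              (hRcard z (hZ y hy).2.2.1)) (Nat.le_add_left _ _)
            exact Finset.mem_inter.2 ⟨(hZ y hy).2.1, ((hZ y hy).2.2.2 hz).2⟩
          · exact le_trans ((Finset.card_le_card fun y hy => (hZ y hy).2.1).trans
              (hnW z hz)) (Nat.le_add_right _ _))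
      (fun Z hZ => (Finset.card_le_card fun z hz => (hZ z hz).1).trans (hLm x hx))
      (fun y hy => ⟨(hY y hy).1, (hY y hy).2.1, (hY y hy).2.2.2⟩))
  refine (vertexRankingNumber_two_le_of_layers (T := T) (W := W) (R := R)
    (fun v hv => (Finset.mem_filter.1 hv).2.2.1)
    χ ψ ?_ ?_).trans (Nat.add_le_add_left hTcard _)
  · intro x y hxT hyT hxW hyW hxy h
    have hx : x ∈ X := Finset.mem_filter.2 ⟨hxW, hxT⟩
    have hy : y ∈ X := Finset.mem_filter.2 ⟨hyW, hyT⟩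
    refine ⟨fun hadj => hχ x hx y hy ⟨hxy, .inl hadj⟩ h, fun z hz hxz hzy => ?_⟩
    by_contra hzR
    refine hχ x hx y hy ⟨hxy, .inr ⟨z, hxz, hzy, hz, fun hQ => hzR ?_⟩⟩ h
    exact Finset.mem_filter.2 ⟨Finset.mem_univ _, hz, hQ.1, x, mem_post_iff_mem_pre.1 hQ.2.1, y,
      mem_post_iff_mem_pre.1 hQ.2.2, hx, hy, hxy, h⟩
  · intro x y hxT hyT hxW hyW hxy h
    have hx : x ∈ L := Finset.mem_filter.2 ⟨Finset.mem_univ _, hxT, hxW⟩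
    have hy : y ∈ L := Finset.mem_filter.2 ⟨Finset.mem_univ _, hyT, hyW⟩
    refine ⟨fun hadj => hψ x hx y hy ⟨hxy, .inl hadj⟩ h, fun z hz hxz hzy => ?_⟩
    by_contra hzW
    refine hψ x hx y hy ⟨hxy, .inr ⟨z, hxz, hzy, hz, fun hzW' => ?_⟩⟩ h
    by_contra hxyR
    exact hzW ⟨hzW', hxyR⟩

end Main
end SimpleGraph

theorem theorem1 (d : ℕ) (hd : 1 ≤ d) :
    ∃ c : ℝ, ∀ n : ℕ, d ≤ n → 2 ≤ n →
      ∀ (V : Type*) [Fintype V], Fintype.card V = n →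
        ∀ G : SimpleGraph V, G.IsDegenerate d →
          (G.vertexRankingNumber 2 : ℝ) ≤ c * (n : ℝ) ^ (1 / 3 : ℝ) * Real.log n := by
  -- Each term is at most a multiple of d² m log n, with m ≤ 2 n^(1/3); 200 leaves some slack.
  refine ⟨200 * (d : ℝ) ^ 2, fun n _ hn V _ hV G hG => ?_⟩
  set t : ℝ := (n : ℝ) ^ (1 / 3 : ℝ) with ht
  set l : ℝ := Real.log n with hl
  have hn' : (2 : ℝ) ≤ n := by exact_mod_cast hn
  have ht1 : 1 ≤ t := Real.one_le_rpow (by linarith) (by norm_num)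
  have hl1 : 1 / 2 ≤ l := by
    have := Real.log_le_log (by norm_num) hn'
    linarith [Real.log_two_gt_d9]
  have hd1 : (1 : ℝ) ≤ d := by exact_mod_cast hd
  set m := ⌈t⌉₊ with hm
  have hm0 : 0 < m := Nat.ceil_pos.2 (by linarith)
  have hmt : t ≤ m := Nat.le_ceil t
  have hm2 : (m : ℝ) ≤ 2 * t := by
    have := Nat.ceil_lt_add_one (a := t) (by linarith)
    linarith
  have hcube : Fintype.card V ≤ m ^ 3 := by
    have h1 : t ^ 3 = n := by
      rw [ht, ← Real.rpow_natCast, ← Real.rpow_mul (by linarith)]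
      norm_num
    have h2 : (n : ℝ) ≤ (m : ℝ) ^ 3 := h1 ▸ pow_le_pow_left₀ (by linarith) hmt 3
    rw [hV]
    exact_mod_cast h2
  set ρ := ⌈(m : ℝ) * (l + 2 * d)⌉₊ with hρ
  have hm1 : (1 : ℝ) ≤ m := by exact_mod_cast hm0
  have hlow : 0 ≤ (m : ℝ) * (l + 2 * d) := by positivity
  have hρ2 : (ρ : ℝ) ≤ m * (l + 2 * d) + 1 := (Nat.ceil_lt_add_one hlow).le
  have key := hG.vertexRankingNumber_two_le (ρ := ρ) (by omega) hm0 hcube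
    (by rw [hV]; exact Nat.le_ceil _)
  have key' : (G.vertexRankingNumber 2 : ℝ) ≤
      2 * (2 * (d + d * d + d * (m + ρ) + m * d + d * m)) +
        2 * (d + d * d + d * m + m * d + d * m) + (d * m + d * d * m) := by exact_mod_cast key
  have e1 : (d : ℝ) ≤ d ^ 2 * m := by nlinarith [mul_le_mul hd1 hm1 zero_le_one (by linarith)]
  have e2 : (d : ℝ) ^ 2 ≤ d ^ 2 * m := le_mul_of_one_le_right (by positivity) hm1
  have e3 : (d : ℝ) * m ≤ d ^ 2 * m := by gcongr; exact le_self_pow₀ hd1 two_ne_zero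
  have e4 : (d : ℝ) * ρ ≤ d * (m * (l + 2 * d) + 1) := by gcongr
  have e5 : (d : ℝ) * m * l ≤ d ^ 2 * m * l := by gcongr
  have e6 : (d : ℝ) ^ 2 * m ≤ 2 * (d ^ 2 * m * l) := by
    have := mul_le_mul_of_nonneg_left hl1 (by positivity : 0 ≤ (d : ℝ) ^ 2 * m)
    linarith
  have e7 : (d : ℝ) ^ 2 * m * l ≤ 2 * (d ^ 2 * t * l) := by
    have := mul_le_mul_of_nonneg_left hm2 (by positivity : 0 ≤ (d : ℝ) ^ 2 * l)
    linarith
  have e8 : 0 ≤ (d : ℝ) ^ 2 * t * l := by positivity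
  linarith
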